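/- Let $G$ be a discrete group with left regular representation $\lambda$ on $\ell^2(G)$, $(\lambda_g f)(x)=f(g^{-1}x)$. For a subgroup $K\le G$ let $L(K)\subseteq B(\ell^2(G))$ be the von Neumann algebra generated by $\{\lambda_k : k\in K\}$, so that $L(K)\subseteq L(G)$. For von Neumann algebras $B\subseteq M$ let $\mathcal N_M(B)=\{u\in M \text{ unitary} : uBu^*=B\}$. A masa in $M$ is a maximal abelian self-adjoint subalgebra of $M$. A masa $B$ in $M$ is called singular if $\mathcal N_M(B)\subseteq B$. A masa $B$ in a finite von Neumann algebra $M$ (such as $L(G)$) is called Cartan if $\mathcal N_M(B)''=M$. Let $H\le G$ be an abelian subgroup such that for every $g\in G\setminus H$ the set $\{hgh^{-1} : h\in H\}$ is infinite. Then $L(H)$ is a masa in $L(G)$, and $$\mathcal N_{L(G)}(L(H))''=L(\mathcal N_G(H)),\qquad \mathcal N_G(H)=\{g\in G : gHg^{-1}=H\}.$$ Moreover, $L(H)$ is a singular masa in $L(G)$ if and only if $\mathcal N_G(H)=H$, and $L(H)$ is a Cartan masa in $L(G)$ if and only if $H$ is a normal subgroup of $G$. -/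

import Mathlib

open scoped ENNReal

namespace GroupVN

/-- The Hilbert space `ℓ²(G)` of square summable complex functions on the discrete group `G`. -/
abbrev L2 (G : Type*) : Type _ := lp (fun _ : G => ℂ) 2

/-- Left translation by `g` as a linear isometry of `ℓ²(G)`: `(leftShift g f) x = f (g⁻¹ * x)`. -/
noncomputable def leftShift {G : Type*} [Group G] (g : G) : L2 G →ₗᵢ[ℂ] L2 G where
  toFun f := ⟨fun x => f (g⁻¹ * x), by
    have h2 : 0 < (2 : ℝ≥0∞).toReal := by norm_num
    have h := (lp.memℓp f).summable h2
    exact memℓp_gen ((Equiv.mulLeft g⁻¹).summable_iff.mpr h)⟩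
  map_add' _ _ := rfl
  map_smul' _ _ := rfl
  norm_map' f := by
    have h2 : 0 < (2 : ℝ≥0∞).toReal := by norm_num
    rw [lp.norm_eq_tsum_rpow h2, lp.norm_eq_tsum_rpow h2]
    congr 1
    exact (Equiv.mulLeft g⁻¹).tsum_eq fun x => ‖f x‖ ^ (2 : ℝ≥0∞).toReal

/-- The left regular representation on `ℓ²(G)`, as bounded operators. -/
noncomputable def leftReg {G : Type*} [Group G] (g : G) : L2 G →L[ℂ] L2 G :=
  (leftShift g).toContinuousLinearMap

theorem leftReg_apply {G : Type*} [Group G] (g : G) (f : L2 G) (x : G) :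
    leftReg g f x = f (g⁻¹ * x) := rfl

section
variable {E : Type*} [NormedAddCommGroup E] [InnerProductSpace ℂ E] [CompleteSpace E]

/-- The von Neumann algebra `W*(S) = (S ∪ S*)''` generated by a set `S` of bounded operators. -/
noncomputable def generated (S : Set (E →L[ℂ] E)) : VonNeumannAlgebra E where
  toStarSubalgebra :=
    StarSubalgebra.centralizer ℂ (StarSubalgebra.centralizer ℂ S : Set (E →L[ℂ] E))
  centralizer_centralizer' := by
    change Set.centralizer (Set.centralizer
      ((StarSubalgebra.centralizer ℂ (StarSubalgebra.centralizer ℂ S : Set (E →L[ℂ] E)) :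
        StarSubalgebra ℂ (E →L[ℂ] E)) : Set (E →L[ℂ] E))) =
      ((StarSubalgebra.centralizer ℂ (StarSubalgebra.centralizer ℂ S : Set (E →L[ℂ] E)) :
        StarSubalgebra ℂ (E →L[ℂ] E)) : Set (E →L[ℂ] E))
    rw [StarSubalgebra.coe_centralizer_centralizer, Set.centralizer_centralizer_centralizer]

theorem coe_generated (S : Set (E →L[ℂ] E)) :
    (generated S : Set (E →L[ℂ] E)) = (S ∪ star S).centralizer.centralizer :=
  StarSubalgebra.coe_centralizer_centralizer ℂ S

/-- `B` is a masa in `M`: it is maximal among the abelian `*`-subalgebras of `M`. -/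
def IsMasa (B M : VonNeumannAlgebra E) : Prop :=
  Maximal (fun C : StarSubalgebra ℂ (E →L[ℂ] E) =>
    (∀ x ∈ C, x ∈ M) ∧ ∀ x ∈ C, ∀ y ∈ C, x * y = y * x) B.toStarSubalgebra

/-- The unitary normalizers of `B` in `M`: the unitaries `u` of `M` with `u B u* = B`. -/
def unitaryNormalizers (M B : VonNeumannAlgebra E) : Set (E →L[ℂ] E) :=
  {u | u ∈ M ∧ u ∈ unitary (E →L[ℂ] E) ∧
    (fun b => u * b * star u) '' (B : Set (E →L[ℂ] E)) = B}

/-- A masa `B` in `M` is singular if every unitary of `M` that normalizes `B` lies in `B`. -/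
def IsSingularMasa (B M : VonNeumannAlgebra E) : Prop :=
  IsMasa B M ∧ unitaryNormalizers M B ⊆ B

/-- A masa `B` in a finite von Neumann algebra `M` is Cartan if its unitary normalizers
generate `M`. (For finite `M`, such as the algebra of a discrete group, a normal conditional
expectation onto `B` always exists, so that it is not part of the definition.) -/
def IsCartanMasa (B M : VonNeumannAlgebra E) : Prop :=
  IsMasa B M ∧ (unitaryNormalizers M B).centralizer.centralizer = (M : Set (E →L[ℂ] E))

end

/-- For a subgroup `K` of `G`, the von Neumann algebra `L(K)` acting on `ℓ²(G)`, generated by the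
left translations by elements of `K`. -/
noncomputable def ofSubgroup {G : Type*} [Group G] (K : Subgroup G) : VonNeumannAlgebra (L2 G) :=
  generated (leftReg '' (K : Set G))

/-- The group von Neumann algebra `L(G)`, acting on `ℓ²(G)`. -/
noncomputable def groupVN (G : Type*) [Group G] : VonNeumannAlgebra (L2 G) :=
  generated (Set.range (leftReg : G → L2 G →L[ℂ] L2 G))

end GroupVN

/-! An operator `x` in `L(G)` is determined by its coefficients `x (basisVec 1) g`, and `L(K)`
consists of the `x` whose coefficients vanish off `K` (`mem_ofSubgroup_of_support`). If `x` commutes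
with `L(H)`, its coefficients are constant on `H`-conjugation orbits; square summability kills them
on infinite orbits, so `x` lies in `L(H)`.

For a unitary `u` normalizing `L(H)`, the mass of its coefficients on `gH` is unchanged when `g`
becomes `h * g` (`cosetMass_mul_left`). Total mass being finite, a nonzero coefficient at `g` forces
`HgH` to be finitely many left cosets. As `H` is abelian, `g * k * g⁻¹` then has finitely many
`H`-conjugates for `k ∈ H`, hence lies in `H`. Thus `u` is supported on the normalizer. -/

namespace GroupVN

/-! ### Matrix coefficients of operators on `ℓ²` -/

section Coordinates

variable {ι : Type*}

theorem L2.summable_norm_sq (f : L2 ι) : Summable fun i => ‖f i‖ ^ 2 := by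
  have h := (lp.memℓp f).summable (p := 2) (by norm_num)
  simpa using h

theorem L2.norm_sq_eq_tsum (f : L2 ι) : ‖f‖ ^ 2 = ∑' i, ‖f i‖ ^ 2 := by
  have h := lp.norm_rpow_eq_tsum (p := 2) (by norm_num) f
  simpa using h

theorem finite_setOf_eq_of_summable {α : Type*} {F : α → ℝ} (hF : Summable F) {c : ℝ}
    (hc : 0 < c) : {i | F i = c}.Finite := by
  have h := hF.tendsto_cofinite_zero.eventually (gt_mem_nhds hc)
  refine (Filter.eventually_cofinite.mp h).subset fun i hi => ?_
  simp only [Set.mem_ofPred_eq] at hi ⊢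
  exact not_lt.mpr hi.ge

/-- The canonical basis vectors of `ℓ²`. -/
noncomputable def basisVec (i : ι) : L2 ι :=
  open Classical in lp.single 2 i (1 : ℂ)

open Classical in
theorem basisVec_apply (i j : ι) : basisVec i j = if j = i then (1 : ℂ) else 0 := by
  simp [basisVec, Pi.single_apply]

theorem basisVec_self (i : ι) : basisVec i i = 1 := by
  classical
  simp [basisVec_apply]

theorem inner_basisVec_left (i : ι) (f : L2 ι) : inner ℂ (basisVec i) f = f i := by
  classical
  simp [basisVec, lp.inner_single_left]

theorem inner_basisVec_right (i : ι) (f : L2 ι) :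
    inner ℂ f (basisVec i) = (starRingEnd ℂ) (f i) := by
  rw [← inner_conj_symm, inner_basisVec_left]

theorem hasSum_basisVec (f : L2 ι) : HasSum (fun i => f i • basisVec i) f := by
  classical
  have h := lp.hasSum_single (p := 2) (by norm_num) f
  convert h using 2 with i
  rw [basisVec, ← lp.single_smul]
  simp

/-- A bounded operator on `ℓ²` acts by its matrix. -/
theorem apply_eq_tsum (A : L2 ι →L[ℂ] L2 ι) (f : L2 ι) (s : ι) :
    A f s = ∑' i, A (basisVec i) s * f i := by
  have h := ((hasSum_basisVec f).mapL A).mapL (innerSL ℂ (basisVec s))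
  simp only [innerSL_apply_apply, map_smul, inner_basisVec_left] at h
  rw [← h.tsum_eq]
  exact tsum_congr fun i => mul_comm _ _

theorem ext_basisVec {A A' : L2 ι →L[ℂ] L2 ι} (h : ∀ i s, A (basisVec i) s = A' (basisVec i) s) :
    A = A' := by
  ext f s
  simp only [apply_eq_tsum _ f, h]

theorem star_apply_basisVec (A : L2 ι →L[ℂ] L2 ι) (i j : ι) :
    (star A) (basisVec i) j = (starRingEnd ℂ) (A (basisVec j) i) := by
  rw [← inner_basisVec_left, ContinuousLinearMap.star_eq_adjoint,
    ContinuousLinearMap.adjoint_inner_right, inner_basisVec_right]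

theorem memℓp_indicator (s : Set ι) (f : L2 ι) : Memℓp (s.indicator (f : ι → ℂ)) 2 :=
  (lp.memℓp f).mono' fun i => by
    by_cases h : i ∈ s <;> simp [h]

/-- The projection of `ℓ²(ι)` onto the functions vanishing outside `s`. -/
noncomputable def restrict (s : Set ι) : L2 ι →L[ℂ] L2 ι :=
  LinearMap.mkContinuous
    { toFun f := ⟨s.indicator (f : ι → ℂ), memℓp_indicator s f⟩
      map_add' f g := Subtype.ext (Set.indicator_add s _ _)
      map_smul' c f := Subtype.ext (Set.indicator_const_smul s c _) } 1 fun f => by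
    rw [one_mul]
    refine lp.norm_mono (by norm_num) fun i => ?_
    exact norm_indicator_le_norm_self _ _

theorem restrict_apply (s : Set ι) (f : L2 ι) (i : ι) :
    restrict s f i = s.indicator (f : ι → ℂ) i := rfl

theorem norm_sq_restrict (s : Set ι) (f : L2 ι) :
    ‖restrict s f‖ ^ 2 = ∑' i : s, ‖f i‖ ^ 2 := by
  rw [L2.norm_sq_eq_tsum, tsum_subtype s fun i => ‖f i‖ ^ 2]
  refine tsum_congr fun i => ?_
  by_cases h : i ∈ s <;> simp [restrict_apply, h]

end Coordinates

/-! ### Fourier coefficients and support in `L(K)` -/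

section Translations

variable {G : Type*} [Group G]

theorem leftReg_basisVec (g t : G) : leftReg g (basisVec t) = basisVec (g * t) := by
  classical
  ext x
  simp only [leftReg_apply, basisVec_apply, inv_mul_eq_iff_eq_mul]

theorem leftReg_mul (g h : G) : leftReg (g * h) = leftReg g * leftReg h := by
  ext f x
  simp [leftReg_apply, mul_assoc]

theorem leftReg_one : leftReg (1 : G) = 1 := by
  ext f x
  simp [leftReg_apply]

theorem star_leftReg (g : G) : star (leftReg g) = leftReg g⁻¹ := by
  classical
  refine ext_basisVec fun i s => ?_
  rw [star_apply_basisVec, leftReg_basisVec, leftReg_basisVec, basisVec_apply, basisVec_apply]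
  simp only [eq_inv_mul_iff_mul_eq, eq_comm (a := i)]
  split_ifs <;> simp

theorem leftReg_mem_unitary (g : G) : leftReg g ∈ unitary (L2 G →L[ℂ] L2 G) := by
  rw [Unitary.mem_iff, star_leftReg, ← leftReg_mul, ← leftReg_mul]
  simp [leftReg_one]

/-- Right translation by `g` on `ℓ²(G)`: `(rightReg g f) x = f (x * g)`. -/
noncomputable def rightReg (g : G) : L2 G →L[ℂ] L2 G :=
  LinearMap.mkContinuous
    { toFun f := ⟨fun x => f (x * g), memℓp_gen
        ((Equiv.mulRight g).summable_iff.mpr ((lp.memℓp f).summable (p := 2) (by norm_num)))⟩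
      map_add' _ _ := rfl
      map_smul' _ _ := rfl } 1 fun f => by
    have h2 : 0 < (2 : ℝ≥0∞).toReal := by norm_num
    rw [one_mul, lp.norm_eq_tsum_rpow h2, lp.norm_eq_tsum_rpow h2]
    refine le_of_eq (congrArg (· ^ _) ?_)
    exact (Equiv.mulRight g).tsum_eq fun x => ‖f x‖ ^ (2 : ℝ≥0∞).toReal

theorem rightReg_apply (g : G) (f : L2 G) (x : G) : rightReg g f x = f (x * g) := rfl

theorem rightReg_basisVec (g t : G) : rightReg g (basisVec t) = basisVec (t * g⁻¹) := by
  classical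
  ext x
  simp only [rightReg_apply, basisVec_apply, eq_mul_inv_iff_mul_eq]

theorem star_image_leftReg (K : Subgroup G) :
    star (leftReg '' (K : Set G)) = leftReg '' (K : Set G) := by
  have h : ∀ x ∈ leftReg '' (K : Set G), star x ∈ leftReg '' (K : Set G) := by
    rintro _ ⟨k, hk, rfl⟩
    exact ⟨k⁻¹, K.inv_mem hk, (star_leftReg k).symm⟩
  ext x
  exact ⟨fun hx => by simpa using h _ hx, h x⟩

theorem coe_ofSubgroup (K : Subgroup G) :
    (ofSubgroup K : Set (L2 G →L[ℂ] L2 G)) =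
      (leftReg '' (K : Set G)).centralizer.centralizer := by
  rw [ofSubgroup, coe_generated, star_image_leftReg, Set.union_self]

theorem mem_ofSubgroup_iff {K : Subgroup G} {x : L2 G →L[ℂ] L2 G} :
    x ∈ ofSubgroup K ↔
      ∀ T : L2 G →L[ℂ] L2 G, (∀ k ∈ K, leftReg k * T = T * leftReg k) → T * x = x * T := by
  rw [← SetLike.mem_coe, coe_ofSubgroup]
  simp [Set.mem_centralizer_iff]

theorem leftReg_mem_ofSubgroup {K : Subgroup G} {k : G} (hk : k ∈ K) :
    leftReg k ∈ ofSubgroup K :=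
  mem_ofSubgroup_iff.mpr fun _ hT => (hT k hk).symm

theorem groupVN_eq_ofSubgroup_top : groupVN G = ofSubgroup (⊤ : Subgroup G) := by
  rw [groupVN, ofSubgroup, Subgroup.coe_top, Set.image_univ]

theorem ofSubgroup_mono {K L : Subgroup G} (h : K ≤ L) {x : L2 G →L[ℂ] L2 G}
    (hx : x ∈ ofSubgroup K) : x ∈ ofSubgroup L :=
  mem_ofSubgroup_iff.mpr fun T hT => mem_ofSubgroup_iff.mp hx T fun k hk => hT k (h hk)

theorem mem_groupVN_of_mem_ofSubgroup {K : Subgroup G} {x : L2 G →L[ℂ] L2 G}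
    (hx : x ∈ ofSubgroup K) : x ∈ groupVN G :=
  groupVN_eq_ofSubgroup_top (G := G) ▸ ofSubgroup_mono le_top hx

theorem leftReg_mem_groupVN (g : G) : leftReg g ∈ groupVN G :=
  mem_groupVN_of_mem_ofSubgroup (leftReg_mem_ofSubgroup (Subgroup.mem_top g))

/-- The matrix of an element `x` of `L(G)` is determined by the vector `x δ₁`. -/
theorem apply_basisVec_of_mem_groupVN {x : L2 G →L[ℂ] L2 G} (hx : x ∈ groupVN G) (t s : G) :
    x (basisVec t) s = x (basisVec 1) (s * t⁻¹) := by
  rw [groupVN_eq_ofSubgroup_top, mem_ofSubgroup_iff] at hx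
  -- Right translations commute with left ones, hence with `L(G)`.
  have h := hx (rightReg t⁻¹) fun k _ => by
    ext f s
    simp [leftReg_apply, rightReg_apply, mul_assoc]
  have h' := congrArg (fun f : L2 G => f s) (DFunLike.congr_fun h (basisVec 1))
  simpa [rightReg_apply, rightReg_basisVec] using h'.symm

theorem restrict_mul_leftReg (K : Subgroup G) {k : G} (hk : k ∈ K) :
    leftReg k * restrict (K : Set G) = restrict (K : Set G) * leftReg k := by
  ext f s
  by_cases hs : s ∈ K <;>
    simp [leftReg_apply, restrict_apply, hs, K.mul_mem_cancel_left (K.inv_mem hk)]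

theorem commute_restrict {K : Subgroup G} {x : L2 G →L[ℂ] L2 G} (hx : x ∈ ofSubgroup K) :
    restrict (K : Set G) * x = x * restrict (K : Set G) :=
  mem_ofSubgroup_iff.mp hx _ fun _ hk => restrict_mul_leftReg K hk

theorem apply_eq_zero_of_mem_ofSubgroup {K : Subgroup G} {x : L2 G →L[ℂ] L2 G}
    (hx : x ∈ ofSubgroup K) {g : G} (hg : g ∉ K) : x (basisVec 1) g = 0 := by
  classical
  have h1 : restrict (K : Set G) (basisVec 1) = basisVec 1 := by
    ext s
    by_cases hs : s ∈ K
    · simp [restrict_apply, hs]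
    · have : s ≠ 1 := fun h => hs (h ▸ K.one_mem)
      simp [restrict_apply, hs, basisVec_apply, this]
  have h := congrArg (fun f : L2 G => f g) (DFunLike.congr_fun (commute_restrict hx) (basisVec 1))
  simpa [h1, restrict_apply, hg] using h.symm

/-- An element of `L(G)` whose Fourier coefficients are supported on `K` lies in `L(K)`. -/
theorem mem_ofSubgroup_of_support {K : Subgroup G} {x : L2 G →L[ℂ] L2 G} (hx : x ∈ groupVN G)
    (hK : ∀ g, g ∉ K → x (basisVec 1) g = 0) : x ∈ ofSubgroup K := by
  refine mem_ofSubgroup_iff.mpr fun T hT => ext_basisVec fun t s => ?_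
  change T (x (basisVec t)) s = x (T (basisVec t)) s
  rw [apply_eq_tsum T, apply_eq_tsum x]
  -- The substitution `u ↦ t * u⁻¹ * s` gives both sums the same coefficient of `x`, at `u * t⁻¹`.
  -- Only `u * t⁻¹ ∈ K` matters, and there `T` commutes with the translation.
  let e : G ≃ G := (Equiv.inv G).trans ((Equiv.mulLeft t).trans (Equiv.mulRight s))
  rw [← e.tsum_eq fun u => x (basisVec u) s * T (basisVec t) u]
  refine tsum_congr fun u => ?_
  have he : e u = (u * t⁻¹)⁻¹ * s := by simp [e]
  rw [apply_basisVec_of_mem_groupVN hx t u, apply_basisVec_of_mem_groupVN hx (e u) s, he,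
    show s * ((u * t⁻¹)⁻¹ * s)⁻¹ = u * t⁻¹ by group]
  by_cases hu : u * t⁻¹ ∈ K
  · have h := congrArg (fun f : L2 G => f s) (DFunLike.congr_fun (hT _ hu) (basisVec t))
    simp only [mul_apply_eq_comp, leftReg_apply, leftReg_basisVec,
      inv_mul_cancel_right] at h
    rw [← h, mul_comm]
  · rw [hK _ hu, mul_zero, zero_mul]

theorem leftReg_mem_ofSubgroup_iff {K : Subgroup G} {g : G} :
    leftReg g ∈ ofSubgroup K ↔ g ∈ K := by
  refine ⟨fun h => ?_, leftReg_mem_ofSubgroup⟩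
  by_contra hg
  have := apply_eq_zero_of_mem_ofSubgroup h hg
  rw [leftReg_basisVec, mul_one, basisVec_self] at this
  exact one_ne_zero this

end Translations

theorem mem_unitaryNormalizers_iff {E : Type*} [NormedAddCommGroup E] [InnerProductSpace ℂ E]
    [CompleteSpace E] {M B : VonNeumannAlgebra E} {u : E →L[ℂ] E} :
    u ∈ unitaryNormalizers M B ↔ u ∈ M ∧ u ∈ unitary (E →L[ℂ] E) ∧
      (∀ b ∈ B, u * b * star u ∈ B) ∧ ∀ b ∈ B, star u * b * u ∈ B := by
  refine and_congr_right fun _ => and_congr_right fun hu => ?_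
  have h1 : star u * u = 1 := Unitary.star_mul_self_of_mem hu
  have h2 : u * star u = 1 := Unitary.mul_star_self_of_mem hu
  constructor
  · intro h
    refine ⟨fun b hb => h.subset ⟨b, hb, rfl⟩, fun b hb => ?_⟩
    obtain ⟨c, hc, rfl⟩ := h.superset hb
    have : star u * (u * c * star u) * u = c := by
      calc _ = (star u * u) * c * (star u * u) := by simp only [mul_assoc]
        _ = c := by simp [h1]
    simpa [this] using hc
  · rintro ⟨ha, hb⟩
    refine Set.Subset.antisymm (Set.image_subset_iff.mpr ha) fun b hbB => ⟨_, hb b hbB, ?_⟩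
    calc u * (star u * b * u) * star u = (u * star u) * b * (u * star u) := by
          simp only [mul_assoc]
      _ = b := by simp [h2]

/-! ### Unitary normalizers and masses of cosets -/

section Normalizers

variable {G : Type*} [Group G] {H : Subgroup G}

/-- The square of the norm of the restriction of `f` to the left coset `g K`. -/
noncomputable def cosetMass (K : Subgroup G) (f : L2 G) (g : G) : ℝ :=
  ∑' k : K, ‖f (g * k)‖ ^ 2

theorem cosetMass_mul_right (K : Subgroup G) (f : L2 G) (g : G) {k : G} (hk : k ∈ K) :
    cosetMass K f (g * k) = cosetMass K f g := by
  rw [cosetMass, cosetMass,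
    ← (Equiv.mulLeft (⟨k, hk⟩ : K)).tsum_eq fun c : K => ‖f (g * c)‖ ^ 2]
  simp [mul_assoc]

theorem norm_sq_le_cosetMass (K : Subgroup G) (f : L2 G) (g : G) :
    ‖f g‖ ^ 2 ≤ cosetMass K f g := by
  have hs : Summable fun k : K => ‖f (g * k)‖ ^ 2 :=
    f.summable_norm_sq.comp_injective ((mul_right_injective g).comp Subtype.val_injective)
  simpa [cosetMass] using hs.le_tsum 1 fun _ _ => sq_nonneg _

theorem cosetMass_out (K : Subgroup G) (f : L2 G) (g : G) :
    cosetMass K f (g : G ⧸ K).out = cosetMass K f g := by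
  obtain ⟨k, hk⟩ := QuotientGroup.mk_out_eq_mul K g
  rw [hk, cosetMass_mul_right K f g k.2]

theorem summable_cosetMass_out (K : Subgroup G) (f : L2 G) :
    Summable fun q : G ⧸ K => cosetMass K f q.out := by
  let φ : (G ⧸ K) × K → G := fun p => p.1.out * p.2
  have hφ : Function.Injective φ := by
    rintro ⟨q, k⟩ ⟨q', k'⟩ h
    have hq : q = q' := by
      have := congrArg (fun x : G => (x : G ⧸ K)) h
      simpa [φ] using this
    subst hq
    simpa [φ] using h
  exact (f.summable_norm_sq.comp_injective hφ).prod

/-- The mass of the Fourier coefficients of `u` on the coset `g H` is the norm of the projection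
of `u* δ_g` on `ℓ²(H)`. -/
theorem norm_sq_restrict_star {u : L2 G →L[ℂ] L2 G} (hu : u ∈ groupVN G) (g : G) :
    ‖restrict (H : Set G) (star u (basisVec g))‖ ^ 2 = cosetMass H (u (basisVec 1)) g := by
  rw [norm_sq_restrict, cosetMass, ← (Equiv.inv H).tsum_eq]
  refine tsum_congr fun k => ?_
  rw [star_apply_basisVec, RCLike.norm_conj, apply_basisVec_of_mem_groupVN hu]
  simp

/-- The unitary `b = star u * leftReg h * u` lies in `L(H)`, so it commutes with the projection onto
`ℓ²(H)`, and it carries `star u (basisVec g)` to `star u (basisVec (h * g))`. The two projected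
vectors therefore have equal norm. -/
theorem cosetMass_mul_left {u : L2 G →L[ℂ] L2 G} (hu : u ∈ groupVN G)
    (huu : u ∈ unitary (L2 G →L[ℂ] L2 G))
    (hn : ∀ b ∈ ofSubgroup H, star u * b * u ∈ ofSubgroup H) {h : G} (hh : h ∈ H) (g : G) :
    cosetMass H (u (basisVec 1)) (h * g) = cosetMass H (u (basisVec 1)) g := by
  have hb := hn _ (leftReg_mem_ofSubgroup hh)
  have hbu : star u * leftReg h * u ∈ unitary (L2 G →L[ℂ] L2 G) :=
    mul_mem (mul_mem (Unitary.star_mem huu) (leftReg_mem_unitary h)) huu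
  have huv : u * star u = 1 := Unitary.mul_star_self_of_mem huu
  rw [← norm_sq_restrict_star hu, ← norm_sq_restrict_star hu, ← leftReg_basisVec]
  have h1 : star u (leftReg h (basisVec g)) =
      (star u * leftReg h * u) (star u (basisVec g)) := by
    have : star u * leftReg h = star u * leftReg h * u * star u := by
      rw [mul_assoc _ u, huv, mul_one]
    exact DFunLike.congr_fun this (basisVec g)
  have h2 := DFunLike.congr_fun (commute_restrict hb) (star u (basisVec g))
  rw [mul_apply_eq_comp, mul_apply_eq_comp _ (restrict _)] at h2
  rw [h1, h2, ContinuousLinearMap.norm_map_of_mem_unitary hbu]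

/-- If the coefficient at `g` of a unitary normalizing `L(H)` does not vanish, then the double coset
`H g H` consists of finitely many left cosets of `H`. -/
theorem finite_cosets_of_apply_ne_zero {u : L2 G →L[ℂ] L2 G} (hu : u ∈ groupVN G)
    (huu : u ∈ unitary (L2 G →L[ℂ] L2 G))
    (hn : ∀ b ∈ ofSubgroup H, star u * b * u ∈ ofSubgroup H) {g : G}
    (hg : u (basisVec 1) g ≠ 0) : ((fun h : G => ((h * g : G) : G ⧸ H)) '' (H : Set G)).Finite := by
  have hpos : 0 < cosetMass H (u (basisVec 1)) g :=
    lt_of_lt_of_le (by positivity) (norm_sq_le_cosetMass H _ g)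
  refine (finite_setOf_eq_of_summable (summable_cosetMass_out H (u (basisVec 1))) hpos).subset ?_
  rintro _ ⟨h, hh, rfl⟩
  exact (cosetMass_out H _ _).trans (cosetMass_mul_left hu huu hn hh g)

theorem conj_mem_of_apply_ne_zero (hcomm : ∀ a ∈ H, ∀ b ∈ H, a * b = b * a)
    (hconj : ∀ g : G, g ∉ H → {x : G | ∃ h ∈ H, x = h * g * h⁻¹}.Infinite)
    {u : L2 G →L[ℂ] L2 G} (hu : u ∈ groupVN G) (huu : u ∈ unitary (L2 G →L[ℂ] L2 G))
    (hn : ∀ b ∈ ofSubgroup H, star u * b * u ∈ ofSubgroup H) {g : G}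
    (hg : u (basisVec 1) g ≠ 0) {k : G} (hk : k ∈ H) : g * k * g⁻¹ ∈ H := by
  by_contra hy
  refine hconj _ hy (((finite_cosets_of_apply_ne_zero hu huu hn hg).image
    fun q : G ⧸ H => q.out * k * q.out⁻¹).subset ?_)
  rintro _ ⟨h, hh, rfl⟩
  refine ⟨_, ⟨h, hh, rfl⟩, ?_⟩
  -- Conjugating `k` by `h * g` depends only on the coset of `h * g`, since `c ∈ H` commutes with
  -- `k`.
  obtain ⟨c, hc⟩ := QuotientGroup.mk_out_eq_mul H (h * g)
  have hck : (c : G) * k * (c : G)⁻¹ = k := by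
    rw [hcomm _ c.2 _ hk, mul_inv_cancel_right]
  simp only [hc]
  calc h * g * c * k * (h * g * c)⁻¹ = h * g * (c * k * (c : G)⁻¹) * (h * g)⁻¹ := by group
    _ = h * (g * k * g⁻¹) * h⁻¹ := by rw [hck]; group

theorem unitaryNormalizers_subset (hcomm : ∀ a ∈ H, ∀ b ∈ H, a * b = b * a)
    (hconj : ∀ g : G, g ∉ H → {x : G | ∃ h ∈ H, x = h * g * h⁻¹}.Infinite) :
    unitaryNormalizers (groupVN G) (ofSubgroup H) ⊆
      (ofSubgroup (Subgroup.normalizer (H : Set G)) : Set (L2 G →L[ℂ] L2 G)) := by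
  intro u hu
  obtain ⟨hM, huu, h1, h2⟩ := mem_unitaryNormalizers_iff.mp hu
  refine mem_ofSubgroup_of_support hM fun g => not_imp_comm.mp fun hg => ?_
  -- Applying the conjugation lemma to `star u` at `g⁻¹` gives the reverse inclusion `g⁻¹ * H * g ⊆
  -- H`.
  have hg' : (star u) (basisVec 1) g⁻¹ ≠ 0 := by
    rw [star_apply_basisVec, apply_basisVec_of_mem_groupVN hM]
    simpa using hg
  refine Subgroup.mem_normalizer_iff.mpr fun k =>
    ⟨fun hk => conj_mem_of_apply_ne_zero hcomm hconj hM huu h2 hg hk, fun hk => ?_⟩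
  have h := conj_mem_of_apply_ne_zero hcomm hconj (star_mem hM) (Unitary.star_mem huu)
    (by simpa using h1) hg' hk
  simpa [mul_assoc] using h

/-- The coefficient of the conjugate at `s` is that of `b` at `g⁻¹ * s * g`. -/
theorem conj_leftReg_mem {g : G} (hg : g ∈ Subgroup.normalizer (H : Set G))
    {b : L2 G →L[ℂ] L2 G} (hb : b ∈ ofSubgroup H) :
    leftReg g * b * leftReg g⁻¹ ∈ ofSubgroup H := by
  have hbM := mem_groupVN_of_mem_ofSubgroup hb
  refine mem_ofSubgroup_of_support
    (mul_mem (mul_mem (leftReg_mem_groupVN g) hbM) (leftReg_mem_groupVN g⁻¹)) fun s hs => ?_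
  simp only [mul_apply_eq_comp, leftReg_basisVec, leftReg_apply]
  rw [apply_basisVec_of_mem_groupVN hbM]
  refine apply_eq_zero_of_mem_ofSubgroup hb fun h => hs ?_
  simpa using (Subgroup.mem_normalizer_iff''.mp hg s).mpr (by simpa using h)

theorem leftReg_mem_unitaryNormalizers {g : G} (hg : g ∈ Subgroup.normalizer (H : Set G)) :
    leftReg g ∈ unitaryNormalizers (groupVN G) (ofSubgroup H) := by
  refine mem_unitaryNormalizers_iff.mpr ⟨leftReg_mem_groupVN g, leftReg_mem_unitary g, ?_⟩
  rw [star_leftReg]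
  exact ⟨fun b hb => conj_leftReg_mem hg hb,
    fun b hb => by simpa using conj_leftReg_mem (inv_mem hg) hb⟩

theorem centralizer_centralizer_unitaryNormalizers
    (hcomm : ∀ a ∈ H, ∀ b ∈ H, a * b = b * a)
    (hconj : ∀ g : G, g ∉ H → {x : G | ∃ h ∈ H, x = h * g * h⁻¹}.Infinite) :
    (unitaryNormalizers (groupVN G) (ofSubgroup H)).centralizer.centralizer =
      (ofSubgroup (Subgroup.normalizer (H : Set G)) : Set (L2 G →L[ℂ] L2 G)) := by
  refine Set.Subset.antisymm ?_ ?_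
  · rw [← VonNeumannAlgebra.centralizer_centralizer
      (ofSubgroup (Subgroup.normalizer (H : Set G)))]
    exact Set.centralizer_subset
      (Set.centralizer_subset (unitaryNormalizers_subset hcomm hconj))
  · rw [coe_ofSubgroup]
    refine Set.centralizer_subset (Set.centralizer_subset ?_)
    rintro _ ⟨g, hg, rfl⟩
    exact leftReg_mem_unitaryNormalizers hg

end Normalizers

/-! ### The relative commutant of `L(H)` -/

section Masa

variable {G : Type*} [Group G] {H : Subgroup G}

theorem ofSubgroup_commute (hcomm : ∀ a ∈ H, ∀ b ∈ H, a * b = b * a) {x y : L2 G →L[ℂ] L2 G}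
    (hx : x ∈ ofSubgroup H) (hy : y ∈ ofSubgroup H) : x * y = y * x := by
  rw [← SetLike.mem_coe, coe_ofSubgroup] at hx hy
  refine Set.centralizer_centralizer_comm_of_comm ?_ _ hx _ hy
  rintro _ ⟨a, ha, rfl⟩ _ ⟨b, hb, rfl⟩
  rw [← leftReg_mul, ← leftReg_mul, hcomm a ha b hb]

/-- The relative commutant of `L(H)` in `L(G)` is contained in `L(H)`. -/
theorem mem_ofSubgroup_of_commute
    (hconj : ∀ g : G, g ∉ H → {x : G | ∃ h ∈ H, x = h * g * h⁻¹}.Infinite)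
    {x : L2 G →L[ℂ] L2 G} (hx : x ∈ groupVN G)
    (hc : ∀ h ∈ H, x * leftReg h = leftReg h * x) : x ∈ ofSubgroup H := by
  refine mem_ofSubgroup_of_support hx fun g hg => ?_
  by_contra hne
  have hpos : 0 < ‖x (basisVec 1) g‖ ^ 2 := by positivity
  refine hconj g hg ((finite_setOf_eq_of_summable
    (L2.summable_norm_sq (x (basisVec 1))) hpos).subset ?_)
  rintro _ ⟨h, hh, rfl⟩
  -- Evaluating the commutation at `h * g` equates the coefficients at `h * g * h⁻¹` and `g`.
  have h1 := congrArg (fun f : L2 G => f (h * g)) (DFunLike.congr_fun (hc h hh) (basisVec 1))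
  simp only [mul_apply_eq_comp, leftReg_basisVec, leftReg_apply, mul_one,
    inv_mul_cancel_left] at h1
  rw [apply_basisVec_of_mem_groupVN hx] at h1
  change ‖_‖ ^ 2 = _
  rw [h1]

theorem isMasa_ofSubgroup (hcomm : ∀ a ∈ H, ∀ b ∈ H, a * b = b * a)
    (hconj : ∀ g : G, g ∉ H → {x : G | ∃ h ∈ H, x = h * g * h⁻¹}.Infinite) :
    IsMasa (ofSubgroup H) (groupVN G) :=
  ⟨⟨fun _ hx => mem_groupVN_of_mem_ofSubgroup hx, fun _ hx _ hy => ofSubgroup_commute hcomm hx hy⟩,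
    fun _ hC hle x hx => mem_ofSubgroup_of_commute hconj (hC.1 x hx) fun _ hh =>
      hC.2 x hx _ (hle (leftReg_mem_ofSubgroup hh))⟩

end Masa

end GroupVN

theorem mainTheorem4 {G : Type*} [Group G] (H : Subgroup G)
    (hcomm : ∀ a ∈ H, ∀ b ∈ H, a * b = b * a)
    (hconj : ∀ g : G, g ∉ H → {x : G | ∃ h ∈ H, x = h * g * h⁻¹}.Infinite) :
    GroupVN.IsMasa (GroupVN.ofSubgroup H) (GroupVN.groupVN G) ∧
    (GroupVN.unitaryNormalizers (GroupVN.groupVN G)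
        (GroupVN.ofSubgroup H)).centralizer.centralizer =
      (GroupVN.ofSubgroup (Subgroup.normalizer (H : Set G)) :
        Set (GroupVN.L2 G →L[ℂ] GroupVN.L2 G)) ∧
    (GroupVN.IsSingularMasa (GroupVN.ofSubgroup H) (GroupVN.groupVN G) ↔
      Subgroup.normalizer (H : Set G) = H) ∧
    (GroupVN.IsCartanMasa (GroupVN.ofSubgroup H) (GroupVN.groupVN G) ↔ H.Normal) := by
  have hmasa := GroupVN.isMasa_ofSubgroup hcomm hconj
  have hnorm := GroupVN.centralizer_centralizer_unitaryNormalizers hcomm hconj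
  refine ⟨hmasa, hnorm, ⟨fun h => ?_, fun h => ⟨hmasa, ?_⟩⟩, ⟨fun h => ?_, fun h => ⟨hmasa, ?_⟩⟩⟩
  · refine le_antisymm (fun g hg => ?_) Subgroup.le_normalizer
    exact GroupVN.leftReg_mem_ofSubgroup_iff.mp
      (h.2 (GroupVN.leftReg_mem_unitaryNormalizers hg))
  · have hsub := GroupVN.unitaryNormalizers_subset hcomm hconj
    rwa [h] at hsub
  · refine Subgroup.normalizer_eq_top_iff.mp (top_le_iff.mp fun g _ => ?_)
    refine GroupVN.leftReg_mem_ofSubgroup_iff.mp (SetLike.mem_coe.mp ?_)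
    rw [← hnorm, h.2]
    exact GroupVN.leftReg_mem_groupVN g
  · rw [hnorm, Subgroup.normalizer_eq_top_iff.mpr h, GroupVN.groupVN_eq_ofSubgroup_top]
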